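/- **Setting.** Let $U:\mathbb{R}_{++}^2\to(0,\infty)$, $(y,z)\mapsto U(y,z)$, be homogeneous of degree $1$ and twice continuously differentiable, with $U_y>0$, $U_z>0$, $U_{yy}<0$, $U_{zz}<0$ and $\lim_{y\downarrow 0}U_y(y,z)=\infty$ for all $z>0$, $\lim_{z\downarrow 0}U_z(y,z)=\infty$ for all $y>0$. Let $0<G_d<G$, $a>0$, $b\ge 0$, $D>0$. Consider the two-period overlapping generations economy in which at date $t=0,1,\dots$ the young and the old are endowed with $a_t=aG^t$ and $b_t=bG^t$ units of the good, and an asset in unit supply, initially owned by the old, pays the dividend $D_t=DG_d^t$. Generation $t$ has utility $U(y_t,z_{t+1})$ and the budget constraints $y_t+P_tx_t=a_t$ and $z_{t+1}=b_{t+1}+(P_{t+1}+D_{t+1})x_t$. An equilibrium is a sequence $(P_t,x_t,y_t,z_t)_{t\ge 0}$ with $P_t>0$ such that every $x_t$ maximizes the utility of generation $t$ among all $x$ giving positive consumption, the initial old consume $z_0=b_0+P_0+D_0$, and the markets clear: $x_t=1$ and $y_t+z_t=a_t+b_t+D_t$. Given the price sequence, put $R_t=(P_{t+1}+D_{t+1})/P_t$,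 $q_0=1$, $q_t=1/\prod_{s=0}^{t-1}R_s$ and $V_t=\frac1{q_t}\sum_{s=t+1}^\infty q_sD_s$ (the fundamental value). There is no asset price bubble if $\lim_{T\to\infty}q_TP_T/q_t=0$ for all $t$, equivalently if $P_t=V_t$ for all $t$. With $\xi_{1t}=P_t/G_d^t$ and $\xi_{2t}=(G_d/G)^t$, the first-order conditions become $\Phi(\xi_t,\xi_{t+1})=0$, where $\Phi=(\Phi_1,\Phi_2)$, $$\Phi_1(\xi,\eta)=G_d(\eta_1+D)U_z-\xi_1U_y,\qquad \Phi_2(\xi,\eta)=\eta_2-(G_d/G)\xi_2,$$ and $U_y,U_z$ are evaluated at $(y,z)=(a-\xi_1\xi_2,\;Gb+G_d(\eta_1+D)\xi_2)\in\mathbb{R}_{++}^2$. A (fundamental) steady state is a point $\xi^*$ with $\xi_1^*>0$ and $\Phi(\xi^*,\xi^*)=0$. A path is a sequence $(\xi_t)_{t\ge 0}$ in $\mathbb{R}_{++}^2$ with $\xi_{2t}=(G_d/G)^t$ and $\Phi(\xi_t,\xi_{t+1})=0$ for all $t$. **Proposition.** 1. There exists a unique $w=w_f^*>0$ satisfying $(U_y/U_z)(1,Gw)=G_d$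 (it depends only on $U$, $G$, $G_d$). 2. A steady state $\xi^*$ of $\Phi$ exists if and only if $b/a>w_f^*$. Under this condition the steady state is unique, and there exists a unique path $(\xi_t^*)_{t\ge 0}$ converging to $\xi^*$. 3. Under the same condition, $P_t=\xi_{1t}^*G_d^t$ is an equilibrium asset price, it is the unique equilibrium asset price with $P_t/G_d^t\to\xi_1^*$, it satisfies $$P_t\sim\frac{G_dU_z}{U_y-G_dU_z}\,D\,G_d^t\qquad(t\to\infty),$$ where $U_y,U_z$ are evaluated at $(a,Gb)$ and $\sim$ means that the ratio tends to $1$, and there is no asset price bubble: $\lim_{T\to\infty}q_TP_T/q_t=0$, the series defining $V_t$ converges and $P_t=V_t$ for all $t$. -/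

import Mathlib

open Filter Topology

noncomputable section

namespace OLG

/-- Partial derivative of the utility function in the first argument (consumption when young). -/
def Uy (U : ℝ → ℝ → ℝ) (y z : ℝ) : ℝ := deriv (fun s => U s z) y

/-- Partial derivative of the utility function in the second argument (consumption when old). -/
def Uz (U : ℝ → ℝ → ℝ) (y z : ℝ) : ℝ := deriv (fun s => U y s) z

/-- The marginal rate of substitution `U_y / U_z`. -/
def mrs (U : ℝ → ℝ → ℝ) (y z : ℝ) : ℝ := Uy U y z / Uz U y z

/-- Regularity of a utility function on the open positive quadrant: positive, homogeneous of
degree one, twice continuously differentiable, strictly increasing with strictly negative second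
own partial derivatives, and the Inada conditions `U_y(0,z) = ∞` and `U_z(y,0) = ∞`.
The values of `U` outside the open positive quadrant are unrestricted and never used. -/
structure RegularUtility (U : ℝ → ℝ → ℝ) : Prop where
  pos : ∀ y z, 0 < y → 0 < z → 0 < U y z
  homogeneous : ∀ c y z, 0 < c → 0 < y → 0 < z → U (c * y) (c * z) = c * U y z
  contDiffOn : ContDiffOn ℝ 2 (fun p : ℝ × ℝ => U p.1 p.2) (Set.Ioi 0 ×ˢ Set.Ioi 0)
  Uy_pos : ∀ y z, 0 < y → 0 < z → 0 < Uy U y z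
  Uz_pos : ∀ y z, 0 < y → 0 < z → 0 < Uz U y z
  Uyy_neg : ∀ y z, 0 < y → 0 < z → deriv (fun s => Uy U s z) y < 0
  Uzz_neg : ∀ y z, 0 < y → 0 < z → deriv (fun s => Uz U y s) z < 0
  inada_y : ∀ z, 0 < z → Tendsto (fun y => Uy U y z) (𝓝[>] 0) atTop
  inada_z : ∀ y, 0 < y → Tendsto (fun z => Uz U y z) (𝓝[>] 0) atTop

/-- The sequence `c * g ^ t`. -/
def geo (c g : ℝ) (t : ℕ) : ℝ := c * g ^ t

/-- Rational expectations equilibrium of the two-period overlapping generations economy with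
endowments `a t` of the young and `b t` of the old at date `t`, and one unit of an asset paying
dividend `D t`, initially held by the old.  `P t` is the asset price, `x t` the number of shares
demanded by the young, `y t` and `z t` the consumption of the young and of the old at date `t`. -/
structure IsEquilibrium (U : ℝ → ℝ → ℝ) (a b D P x y z : ℕ → ℝ) : Prop where
  price_pos : ∀ t, 0 < P t
  young_pos : ∀ t, 0 < y t
  old_pos : ∀ t, 0 < z (t + 1)
  budget_young : ∀ t, y t + P t * x t = a t
  budget_old : ∀ t, z (t + 1) = b (t + 1) + (P (t + 1) + D (t + 1)) * x t
  budget_initial_old : z 0 = b 0 + (P 0 + D 0)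
  optimal : ∀ t x', 0 < a t - P t * x' →
    0 < b (t + 1) + (P (t + 1) + D (t + 1)) * x' →
    U (a t - P t * x') (b (t + 1) + (P (t + 1) + D (t + 1)) * x') ≤ U (y t) (z (t + 1))
  goods_clear : ∀ t, y t + z t = a t + b t + D t
  asset_clear : ∀ t, x t = 1

/-- `P` is the asset price sequence of some equilibrium. -/
def IsEquilibriumPrice (U : ℝ → ℝ → ℝ) (a b D P : ℕ → ℝ) : Prop :=
  ∃ x y z : ℕ → ℝ, IsEquilibrium U a b D P x y z

/-- The gross risk-free rate `R_t = (P_{t+1} + D_{t+1}) / P_t`. -/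
def grossRate (P D : ℕ → ℝ) (t : ℕ) : ℝ := (P (t + 1) + D (t + 1)) / P t

/-- The Arrow-Debreu price `q_t = 1 / (R_0 ⋯ R_{t-1})`, with `q_0 = 1`. -/
def adPrice (P D : ℕ → ℝ) (t : ℕ) : ℝ := 1 / ∏ s ∈ Finset.range t, grossRate P D s

/-- The fundamental value `V_t = (1 / q_t) ∑_{s > t} q_s D_s`. -/
def fundamentalValue (P D : ℕ → ℝ) (t : ℕ) : ℝ :=
  1 / adPrice P D t * ∑' k : ℕ, adPrice P D (t + 1 + k) * D (t + 1 + k)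

/-- The bubble component `B_t = lim_{T → ∞} q_T P_T / q_t` vanishes at every date `t`. -/
def NoBubble (P D : ℕ → ℝ) : Prop :=
  ∀ t, Tendsto (fun T => 1 / adPrice P D t * (adPrice P D T * P T)) atTop (𝓝 0)

/-- Consumption when young as a function of the state `ξ = (ξ₁, ξ₂)`, where `ξ₁` is the detrended
asset price `P_t / G_d ^ t` and `ξ₂` is `(G_d / G) ^ t`; quantities are divided by `G ^ t`. -/
def youngArg (a : ℝ) (ξ : ℝ × ℝ) : ℝ := a - ξ.1 * ξ.2

/-- Consumption when old (divided by `G ^ t`) as a function of the states `ξ`, `η` at two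
consecutive dates. -/
def oldArg (b D G Gd : ℝ) (ξ η : ℝ × ℝ) : ℝ := G * b + Gd * (η.1 + D) * ξ.2

/-- The map `Φ = (Φ₁, Φ₂)` whose zeros `Φ(ξ_t, ξ_{t+1}) = 0` describe the detrended dynamics. -/
def Phi (U : ℝ → ℝ → ℝ) (a b D G Gd : ℝ) (ξ η : ℝ × ℝ) : ℝ × ℝ :=
  (Gd * (η.1 + D) * Uz U (youngArg a ξ) (oldArg b D G Gd ξ η)
      - ξ.1 * Uy U (youngArg a ξ) (oldArg b D G Gd ξ η),
    η.2 - Gd / G * ξ.2)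

/-- `Φ(ξ, η) = 0`, at a point where the arguments of `U_y` and `U_z` lie in the open positive
quadrant, the domain of the utility function. -/
def SolvesPhi (U : ℝ → ℝ → ℝ) (a b D G Gd : ℝ) (ξ η : ℝ × ℝ) : Prop :=
  0 < youngArg a ξ ∧ 0 < oldArg b D G Gd ξ η ∧ Phi U a b D G Gd ξ η = 0

/-- A (fundamental) steady state of `Φ`: `Φ(ξ, ξ) = 0` with positive detrended price. -/
def IsSteadyState (U : ℝ → ℝ → ℝ) (a b D G Gd : ℝ) (ξ : ℝ × ℝ) : Prop :=
  0 < ξ.1 ∧ SolvesPhi U a b D G Gd ξ ξ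

/-- A path of the detrended system: `ξ_t` has positive coordinates, `ξ_{2,t} = (G_d / G) ^ t`, and
`Φ(ξ_t, ξ_{t+1}) = 0` for all `t`. -/
def IsPath (U : ℝ → ℝ → ℝ) (a b D G Gd : ℝ) (ξ : ℕ → ℝ × ℝ) : Prop :=
  ∀ t, 0 < (ξ t).1 ∧ (ξ t).2 = (Gd / G) ^ t ∧ SolvesPhi U a b D G Gd (ξ t) (ξ (t + 1))

end OLG

end

/-! By homogeneity the marginal utilities depend only on the ratio w of old to young consumption,
and m(w) = (U_y/U_z)(1, w) is C¹, strictly increasing and takes every positive value; this gives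
w_f. With e_t = (G_d/G)^t the detrended first-order condition is p_t m(w_t) = G_d (p_{t+1} + D),
where w_t = (Gb + G_d (p_{t+1} + D) e_t) / (a - p_t e_t). At e = 0 the ratio is Gb/a whatever the
prices, so for b > 0 the limit recursion is affine, with slope m₀/G_d for m₀ = m(Gb/a). Its fixed
point p₀ = G_d D/(m₀ - G_d) is positive exactly when m₀ > G_d, that is, b/a > w_f.

The steady state is then a saddle: prices expand forward while e_t contracts. No stable manifold
theorem is invoked; the argument runs backward in time. `exists_lipschitz_of_const` makes the
perturbation of m₀ small. `exists_eventual_solution` solves backward on shrinking intervals and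
passes to an infinite horizon by compactness. `eventually_eq_of_solution` shows that the gap between
two solutions cannot shrink forward, so it vanishes if both converge. Monotonicity of m extends
existence and uniqueness back to date 0.

Concavity makes the first-order condition equivalent to optimality (`isEquilibriumPrice_iff`).
Prices and dividends both grow like G_d^t, so the price-dividend ratio is bounded, which forces
discounted prices to decay geometrically and excludes a bubble. -/

open Filter Topology

namespace OLG

/-! ### Homogeneous utility reduced to one variable -/

namespace RegularUtility

variable {U : ℝ → ℝ → ℝ}

lemma contDiffOn_slice (hU : RegularUtility U) :
    ContDiffOn ℝ 2 (fun w => U 1 w) (Set.Ioi 0) := by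
  have h : ContDiffOn ℝ 2 (fun w : ℝ => ((1 : ℝ), w)) (Set.Ioi 0) :=
    (contDiff_const.prodMk contDiff_id).contDiffOn
  exact hU.contDiffOn.comp h fun w hw => ⟨by simp, hw⟩

lemma hasDerivAt_slice (hU : RegularUtility U) {w : ℝ} (hw : 0 < w) :
    HasDerivAt (fun s => U 1 s) (Uz U 1 w) w :=
  ((hU.contDiffOn_slice.contDiffAt (Ioi_mem_nhds hw)).differentiableAt (by simp)).hasDerivAt

lemma eq_mul_slice (hU : RegularUtility U) {y z : ℝ} (hy : 0 < y) (hz : 0 < z) :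
    U y z = y * U 1 (z / y) := by
  have h := hU.homogeneous y 1 (z / y) hy one_pos (div_pos hz hy)
  rwa [mul_one, mul_div_cancel₀ _ hy.ne'] at h

lemma hasDerivAt_old (hU : RegularUtility U) {y z : ℝ} (hy : 0 < y) (hz : 0 < z) :
    HasDerivAt (fun s => U y s) (Uz U 1 (z / y)) z := by
  have h1 : HasDerivAt (fun s => y * U 1 (s / y)) (y * (Uz U 1 (z / y) * (1 / y))) z :=
    ((hU.hasDerivAt_slice (div_pos hz hy)).comp z
      ((hasDerivAt_id z).div_const y)).const_mul y
  have h2 : (fun s => U y s) =ᶠ[𝓝 z] fun s => y * U 1 (s / y) := by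
    filter_upwards [Ioi_mem_nhds hz] with s hs using hU.eq_mul_slice hy hs
  refine (h1.congr_of_eventuallyEq h2).congr_deriv ?_
  field_simp

lemma hasDerivAt_young (hU : RegularUtility U) {y z : ℝ} (hy : 0 < y) (hz : 0 < z) :
    HasDerivAt (fun s => U s z) (U 1 (z / y) - z / y * Uz U 1 (z / y)) y := by
  have h0 : HasDerivAt (fun s : ℝ => z / s) (-z / y ^ 2) y := by
    simpa using (hasDerivAt_const y z).fun_div (hasDerivAt_id y) hy.ne'
  have h1 : HasDerivAt (fun s => s * U 1 (z / s))
      (1 * U 1 (z / y) + y * (Uz U 1 (z / y) * (-z / y ^ 2))) y :=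
    (hasDerivAt_id y).fun_mul ((hU.hasDerivAt_slice (div_pos hz hy)).comp y h0)
  have h2 : (fun s => U s z) =ᶠ[𝓝 y] fun s => s * U 1 (z / s) := by
    filter_upwards [Ioi_mem_nhds hy] with s hs using hU.eq_mul_slice hs hz
  refine (h1.congr_of_eventuallyEq h2).congr_deriv ?_
  field_simp
  ring

lemma Uz_eq (hU : RegularUtility U) {y z : ℝ} (hy : 0 < y) (hz : 0 < z) :
    Uz U y z = Uz U 1 (z / y) := (hU.hasDerivAt_old hy hz).deriv

lemma Uy_eq_slice (hU : RegularUtility U) {y z : ℝ} (hy : 0 < y) (hz : 0 < z) :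
    Uy U y z = U 1 (z / y) - z / y * Uz U 1 (z / y) := (hU.hasDerivAt_young hy hz).deriv

lemma Uy_eq (hU : RegularUtility U) {y z : ℝ} (hy : 0 < y) (hz : 0 < z) :
    Uy U y z = Uy U 1 (z / y) := by
  rw [hU.Uy_eq_slice hy hz, hU.Uy_eq_slice one_pos (div_pos hz hy), div_one]

lemma mrs_eq (hU : RegularUtility U) {y z : ℝ} (hy : 0 < y) (hz : 0 < z) :
    mrs U y z = mrs U 1 (z / y) := by
  rw [mrs, mrs, hU.Uy_eq hy hz, hU.Uz_eq hy hz]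

lemma mrs_pos (hU : RegularUtility U) {y z : ℝ} (hy : 0 < y) (hz : 0 < z) : 0 < mrs U y z :=
  div_pos (hU.Uy_pos y z hy hz) (hU.Uz_pos y z hy hz)

lemma contDiffOn_Uz (hU : RegularUtility U) : ContDiffOn ℝ 1 (fun w => Uz U 1 w) (Set.Ioi 0) :=
  hU.contDiffOn_slice.deriv_of_isOpen (m := 1) isOpen_Ioi (by norm_num)

/-- Euler's identity expresses this derivative through the slice U(1, ·) and its derivative, so no
smoothness in y has to be tracked. -/
lemma contDiffOn_Uy (hU : RegularUtility U) : ContDiffOn ℝ 1 (fun w => Uy U 1 w) (Set.Ioi 0) := by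
  have h : ContDiffOn ℝ 1 (fun w => U 1 w - w * Uz U 1 w) (Set.Ioi 0) :=
    (hU.contDiffOn_slice.of_le (by norm_num)).sub (contDiffOn_id.mul hU.contDiffOn_Uz)
  refine h.congr fun w hw => ?_
  rw [hU.Uy_eq_slice one_pos hw, div_one]

lemma contDiffOn_mrs (hU : RegularUtility U) :
    ContDiffOn ℝ 1 (fun w => mrs U 1 w) (Set.Ioi 0) :=
  hU.contDiffOn_Uy.div hU.contDiffOn_Uz fun w hw => (hU.Uz_pos 1 w one_pos hw).ne'

lemma Uz_strictAntiOn (hU : RegularUtility U) :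
    StrictAntiOn (fun w => Uz U 1 w) (Set.Ioi 0) := by
  refine strictAntiOn_of_deriv_neg (convex_Ioi 0) hU.contDiffOn_Uz.continuousOn fun w hw => ?_
  rw [interior_Ioi] at hw
  exact hU.Uzz_neg 1 w one_pos hw

/-- U_y has degree zero, so U_y(1, w) = U_y(1/w, 1); the sign of U_yy and the order-reversing
inversion combine to an increasing function. -/
lemma Uy_strictMonoOn (hU : RegularUtility U) :
    StrictMonoOn (fun w => Uy U 1 w) (Set.Ioi 0) := by
  have hinv : ∀ w : ℝ, 0 < w → Uy U 1 w = Uy U w⁻¹ 1 := fun w hw => by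
    rw [hU.Uy_eq (inv_pos.2 hw) one_pos, one_div, inv_inv]
  have hc : ContinuousOn (fun s => Uy U s 1) (Set.Ioi 0) := by
    have : ContinuousOn (fun s : ℝ => Uy U 1 s⁻¹) (Set.Ioi 0) :=
      hU.contDiffOn_Uy.continuousOn.comp
        (continuousOn_inv₀.mono fun s (hs : 0 < s) => hs.ne') fun s (hs : 0 < s) => inv_pos.2 hs
    refine this.congr fun s hs => ?_
    simp only [hU.Uy_eq hs one_pos, one_div]
  have hanti : StrictAntiOn (fun s => Uy U s 1) (Set.Ioi 0) := by
    refine strictAntiOn_of_deriv_neg (convex_Ioi 0) hc fun w hw => ?_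
    rw [interior_Ioi] at hw
    exact hU.Uyy_neg w 1 hw one_pos
  intro v (hv : 0 < v) w (hw : 0 < w) hvw
  simp only [hinv v hv, hinv w hw]
  exact hanti (inv_pos.2 hw) (inv_pos.2 hv) (inv_strictAnti₀ hv hvw)

lemma mrs_strictMonoOn (hU : RegularUtility U) :
    StrictMonoOn (fun w => mrs U 1 w) (Set.Ioi 0) := by
  intro v (hv : 0 < v) w (hw : 0 < w) hvw
  exact div_lt_div₀ (hU.Uy_strictMonoOn hv hw hvw) (hU.Uz_strictAntiOn hv hw hvw).le
    (hU.Uy_pos 1 w one_pos hw).le (hU.Uz_pos 1 w one_pos hw)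

/-- As w tends to 0 the denominator U_z blows up, while the numerator stays below U_y(1, 1). -/
lemma exists_mrs_le (hU : RegularUtility U) {v : ℝ} (hv : 0 < v) :
    ∃ w, 0 < w ∧ mrs U 1 w ≤ v := by
  have h1 := (hU.inada_z 1 one_pos).eventually_ge_atTop (Uy U 1 1 / v)
  have h2 : ∀ᶠ w : ℝ in 𝓝[>] 0, w ∈ Set.Ioo (0 : ℝ) 1 := Ioo_mem_nhdsGT one_pos
  obtain ⟨w, hw, hw0, hw1⟩ := (h1.and h2).exists
  refine ⟨w, hw0, ?_⟩
  rw [mrs, div_le_iff₀ (hU.Uz_pos 1 w one_pos hw0)]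
  rw [div_le_iff₀ hv] at hw
  have := hU.Uy_strictMonoOn hw0 (Set.mem_Ioi.2 one_pos) hw1
  simp only at this
  linarith

/-- Mirror image: at w = 1/y with y small, U_y blows up and U_z stays below U_z(1, 1). -/
lemma exists_le_mrs (hU : RegularUtility U) (v : ℝ) :
    ∃ w, 0 < w ∧ v ≤ mrs U 1 w := by
  have h1 := (hU.inada_y 1 one_pos).eventually_ge_atTop (|v| * Uz U 1 1)
  have h2 : ∀ᶠ w : ℝ in 𝓝[>] 0, w ∈ Set.Ioo (0 : ℝ) 1 := Ioo_mem_nhdsGT one_pos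
  obtain ⟨y, hy, hy0, hy1⟩ := (h1.and h2).exists
  have hw : 0 < 1 / y := by positivity
  refine ⟨1 / y, hw, ?_⟩
  rw [mrs, le_div_iff₀ (hU.Uz_pos 1 _ one_pos hw), ← hU.Uy_eq hy0 one_pos]
  have := hU.Uz_strictAntiOn (Set.mem_Ioi.2 one_pos) hw ((one_lt_div hy0).2 hy1)
  have h3 := hU.Uz_pos 1 _ one_pos hw
  calc v * Uz U 1 (1 / y) ≤ |v| * Uz U 1 (1 / y) := by gcongr; exact le_abs_self v
    _ ≤ |v| * Uz U 1 1 := by gcongr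
    _ ≤ _ := hy

lemma exists_mrs_eq (hU : RegularUtility U) {v : ℝ} (hv : 0 < v) :
    ∃ w, 0 < w ∧ mrs U 1 w = v := by
  obtain ⟨w₁, h₁, h₁'⟩ := hU.exists_mrs_le hv
  obtain ⟨w₂, h₂, h₂'⟩ := hU.exists_le_mrs v
  obtain ⟨w, hw, hwv⟩ := isPreconnected_Ioi.intermediate_value h₁ h₂
    hU.contDiffOn_mrs.continuousOn ⟨h₁', h₂'⟩
  exact ⟨w, hw, hwv⟩

/-- The tangent line of the concave function `w ↦ U(1, w)` lies above its graph. -/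
lemma slice_le_tangent (hU : RegularUtility U) {v w : ℝ} (hv : 0 < v) (hw : 0 < w) :
    U 1 v ≤ U 1 w + Uz U 1 w * (v - w) := by
  have hconc : ConcaveOn ℝ (Set.Ioi 0) (fun s => U 1 s) := by
    refine AntitoneOn.concaveOn_of_deriv (convex_Ioi 0) hU.contDiffOn_slice.continuousOn ?_ ?_
    · rw [interior_Ioi]
      exact hU.contDiffOn_slice.differentiableOn (by simp)
    · rw [interior_Ioi]
      exact hU.Uz_strictAntiOn.antitoneOn
  rcases lt_trichotomy v w with h | h | h
  · have := hconc.le_slope_of_hasDerivAt hv hw h (hU.hasDerivAt_slice hw)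
    rw [slope_def_field, le_div_iff₀ (by linarith)] at this
    linarith
  · simp [h]
  · have := hconc.slope_le_of_hasDerivAt hw hv h (hU.hasDerivAt_slice hw)
    rw [slope_def_field, div_le_iff₀ (by linarith)] at this
    linarith

lemma euler (hU : RegularUtility U) {y z : ℝ} (hy : 0 < y) (hz : 0 < z) :
    U y z = Uy U y z * y + Uz U y z * z := by
  rw [hU.Uy_eq_slice hy hz, hU.Uz_eq hy hz, hU.eq_mul_slice hy hz]
  field_simp
  ring

/-- The supporting hyperplane of the concave, linearly homogeneous function `U`. -/
lemma le_support (hU : RegularUtility U) {y z y' z' : ℝ} (hy : 0 < y) (hz : 0 < z)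
    (hy' : 0 < y') (hz' : 0 < z') :
    U y' z' ≤ Uy U y z * y' + Uz U y z * z' := by
  have h := mul_le_mul_of_nonneg_left
    (hU.slice_le_tangent (div_pos hz' hy') (div_pos hz hy)) hy'.le
  rw [← hU.eq_mul_slice hy' hz'] at h
  rw [hU.Uy_eq_slice hy hz, hU.Uz_eq hy hz]
  refine h.trans (le_of_eq ?_)
  field_simp
  ring

/-- Differentiates utility along a budget line in the number of shares; this yields the necessity of
the first-order condition. -/
lemma hasDerivAt_line (hU : RegularUtility U) {α β γ δ x : ℝ} (hy : 0 < α + β * x)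
    (hz : 0 < γ + δ * x) :
    HasDerivAt (fun s => U (α + β * s) (γ + δ * s))
      (β * Uy U (α + β * x) (γ + δ * x) + δ * Uz U (α + β * x) (γ + δ * x)) x := by
  set y := α + β * x with hy_def
  set z := γ + δ * x with hz_def
  have hβ : HasDerivAt (fun s => α + β * s) β x := by
    simpa using ((hasDerivAt_id x).const_mul β).const_add α
  have hδ : HasDerivAt (fun s => γ + δ * s) δ x := by
    simpa using ((hasDerivAt_id x).const_mul δ).const_add γ
  have h0 : HasDerivAt (fun s => (γ + δ * s) / (α + β * s)) ((δ * y - z * β) / y ^ 2) x :=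
    hδ.fun_div hβ hy.ne'
  have h1 : HasDerivAt (fun s => (α + β * s) * U 1 ((γ + δ * s) / (α + β * s)))
      (β * U 1 (z / y) + y * (Uz U 1 (z / y) * ((δ * y - z * β) / y ^ 2))) x :=
    hβ.fun_mul ((hU.hasDerivAt_slice (div_pos hz hy)).comp x h0)
  have h2 : (fun s => U (α + β * s) (γ + δ * s)) =ᶠ[𝓝 x]
      fun s => (α + β * s) * U 1 ((γ + δ * s) / (α + β * s)) := by
    filter_upwards [hβ.continuousAt.eventually_const_lt hy,
      hδ.continuousAt.eventually_const_lt hz] with s hs hs' using hU.eq_mul_slice hs hs'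
  refine (h1.congr_of_eventuallyEq h2).congr_deriv ?_
  rw [hU.Uy_eq_slice hy hz, hU.Uz_eq hy hz]
  field_simp
  ring

end RegularUtility

/-! ### Perturbed affine recursions near a saddle point -/

/-- A `C¹` function of `(p, q, e)` that is constant on `e = 0` has, near a point of that plane,
an arbitrarily small Lipschitz constant in `(p, q)`, and varies at most linearly with `e`. -/
lemma exists_lipschitz_of_const {φ : ℝ × ℝ × ℝ → ℝ} {p₀ m₀ : ℝ}
    (hφ : ContDiffAt ℝ 1 φ (p₀, p₀, 0)) (h0 : ∀ p q, φ (p, q, 0) = m₀) {ε : ℝ} (hε : 0 < ε) :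
    ∃ C > 0, ∃ δ > 0, ∀ p q p' q' e : ℝ, |p - p₀| < δ → |q - p₀| < δ → |p' - p₀| < δ →
      |q' - p₀| < δ → |e| < δ →
      |φ (p, q, e) - φ (p', q', e)| ≤ ε * (|p - p'| + |q - q'|) ∧
      |φ (p, q, e) - m₀| ≤ C * |e| := by
  have hs := hφ.hasStrictFDerivAt (by simp)
  set φ' := fderiv ℝ φ (p₀, p₀, 0)
  -- Constancy on the plane e = 0 kills the differential in its directions, so strict
  -- differentiability leaves only the error ε there.
  have hplane : ∀ u v : ℝ, φ' (u, v, 0) = 0 := by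
    intro u v
    have hl : HasFDerivAt φ φ' ((p₀, p₀, 0) : ℝ × ℝ × ℝ) := hs.hasFDerivAt
    have hline : HasDerivAt (fun s : ℝ => ((p₀, p₀, 0) : ℝ × ℝ × ℝ) + s • (u, v, (0 : ℝ)))
        (u, v, 0) 0 := by
      simpa using ((hasDerivAt_id (0 : ℝ)).smul_const (u, v, (0 : ℝ))).const_add
        ((p₀, p₀, 0) : ℝ × ℝ × ℝ)
    have h1 := HasFDerivAt.comp_hasDerivAt (0 : ℝ) (l := φ) (l' := φ') (by simpa using hl) hline
    have h2 : (φ ∘ fun s : ℝ => ((p₀, p₀, 0) : ℝ × ℝ × ℝ) + s • (u, v, (0 : ℝ)))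
        = fun _ => m₀ := by
      funext s
      simp [h0]
    rw [h2] at h1
    exact h1.unique (hasDerivAt_const _ _)
  have hb := hs.isLittleO.def hε
  rw [Metric.eventually_nhds_iff] at hb
  obtain ⟨δ, hδ, hb⟩ := hb
  have hmem : ∀ p q e : ℝ, |p - p₀| < δ → |q - p₀| < δ → |e| < δ →
      dist ((p, q, e) : ℝ × ℝ × ℝ) (p₀, p₀, 0) < δ := by
    intro p q e hp hq he
    simp only [Prod.dist_eq, Real.dist_eq, sub_zero]
    exact max_lt hp (max_lt hq he)
  have key : ∀ p q e p' q' e' : ℝ, |p - p₀| < δ → |q - p₀| < δ → |e| < δ → |p' - p₀| < δ →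
      |q' - p₀| < δ → |e'| < δ →
      |φ (p, q, e) - φ (p', q', e') - φ' (p - p', q - q', e - e')| ≤
        ε * max |p - p'| (max |q - q'| |e - e'|) := by
    intro p q e p' q' e' hp hq he hp' hq' he'
    have := @hb (((p, q, e) : ℝ × ℝ × ℝ), ((p', q', e') : ℝ × ℝ × ℝ)) (by
      rw [Prod.dist_eq]
      exact max_lt (hmem _ _ _ hp hq he) (hmem _ _ _ hp' hq' he'))
    simpa [Prod.norm_def, Real.norm_eq_abs] using this
  refine ⟨‖φ'‖ + ε, by positivity, δ, hδ, fun p q p' q' e hp hq hp' hq' he => ⟨?_, ?_⟩⟩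
  · have := key p q e p' q' e hp hq he hp' hq' he
    rw [sub_self, hplane, sub_zero, abs_zero] at this
    refine this.trans ?_
    gcongr
    have h1 := abs_nonneg (p - p')
    have h2 := abs_nonneg (q - q')
    exact max_le (by linarith) (max_le (by linarith) (by linarith))
  · have := key p q e p q 0 hp hq he hp hq (by simpa using hδ)
    rw [h0, sub_self, sub_self, sub_zero, abs_zero] at this
    have hn := φ'.le_opNorm ((0, 0, e) : ℝ × ℝ × ℝ)
    simp only [Prod.norm_def, norm_zero, Real.norm_eq_abs, abs_nonneg, max_eq_right] at this hn
    have h3 := abs_sub_abs_le_abs_sub (φ (p, q, e) - m₀) (φ' (0, 0, e))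
    linarith

/-- Backward existence on compact intervals gives an infinite solution, by compactness. -/
lemma exists_seq_of_backward {E : ℕ → ℝ → ℝ → Prop} {l u : ℕ → ℝ}
    (hne : ∀ t, l t ≤ u t)
    (hE : ∀ t, IsClosed {x : ℝ × ℝ | x.1 ∈ Set.Icc (l t) (u t) ∧
      x.2 ∈ Set.Icc (l (t + 1)) (u (t + 1)) ∧ E t x.1 x.2})
    (hback : ∀ t, ∀ q ∈ Set.Icc (l (t + 1)) (u (t + 1)), ∃ p ∈ Set.Icc (l t) (u t), E t p q) :
    ∃ p : ℕ → ℝ, ∀ t, p t ∈ Set.Icc (l t) (u t) ∧ E t (p t) (p (t + 1)) := by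
  set K : Set (ℕ → ℝ) := Set.univ.pi fun t => Set.Icc (l t) (u t)
  have hK : IsCompact K := isCompact_univ_pi fun t => isCompact_Icc
  set S : ℕ → Set (ℕ → ℝ) := fun n =>
    K ∩ ⋂ t ∈ Set.Iio n, (fun p : ℕ → ℝ => (p t, p (t + 1))) ⁻¹'
      {x : ℝ × ℝ | x.1 ∈ Set.Icc (l t) (u t) ∧
        x.2 ∈ Set.Icc (l (t + 1)) (u (t + 1)) ∧ E t x.1 x.2}
  -- Finite horizon: solve on a window of length n by prepending one backward step. Outside the
  -- window the entries only need to lie in their intervals.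
  have hfin : ∀ n T, ∃ p : ℕ → ℝ, (∀ t, p t ∈ Set.Icc (l t) (u t)) ∧
      ∀ t, T ≤ t → t < T + n → E t (p t) (p (t + 1)) := by
    intro n
    induction n with
    | zero => exact fun T => ⟨l, fun t => ⟨le_rfl, hne t⟩, fun t h1 h2 => by omega⟩
    | succ n ih =>
      intro T
      obtain ⟨p, hp, hpE⟩ := ih (T + 1)
      obtain ⟨v, hv, hvE⟩ := hback T (p (T + 1)) (hp _)
      refine ⟨Function.update p T v, fun t => ?_, fun t h1 h2 => ?_⟩
      · rcases eq_or_ne t T with rfl | h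
        · simpa using hv
        · simpa [Function.update_of_ne h] using hp t
      · rw [Function.update_of_ne (by omega : t + 1 ≠ T)]
        rcases eq_or_ne t T with rfl | h
        · simpa using hvE
        · rw [Function.update_of_ne h]
          exact hpE t (by omega) (by omega)
  have hclosed : ∀ n, IsClosed (S n) := fun n =>
    hK.isClosed.inter <| isClosed_biInter fun t _ => (hE t).preimage (by fun_prop)
  obtain ⟨p, hp⟩ := IsCompact.nonempty_iInter_of_sequence_nonempty_isCompact_isClosed S
    (fun n => by
      refine Set.inter_subset_inter_right _ (Set.biInter_subset_biInter_left ?_)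
      exact Set.Iio_subset_Iio (Nat.le_succ n))
    (fun n => by
      obtain ⟨p, hp, hpE⟩ := hfin n 0
      refine ⟨p, fun t _ => hp t, ?_⟩
      simp only [Set.mem_iInter]
      exact fun t ht => ⟨hp t, hp (t + 1), hpE t (Nat.zero_le _) (by simpa using ht)⟩)
    (hK.of_isClosed_subset (hclosed 0) Set.inter_subset_left) hclosed
  refine ⟨p, fun t => ?_⟩
  have h := (Set.mem_iInter.1 hp (t + 1)).2
  simp only [Set.mem_iInter] at h
  have := h t (by simp)
  exact ⟨this.1, this.2.2⟩

section Dynamics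

variable {φ : ℝ × ℝ × ℝ → ℝ} {p₀ m₀ g D : ℝ} {e : ℕ → ℝ}

/-- Existence of an eventual solution converging to the steady state `p₀`. -/
lemma exists_eventual_solution
    (hφ : ContDiffAt ℝ 1 φ (p₀, p₀, 0)) (h0 : ∀ p q, φ (p, q, 0) = m₀)
    (hp₀ : 0 < p₀) (hg : 0 < g) (hgm : g < m₀) (hss : m₀ * p₀ = g * (p₀ + D))
    (he : ∀ t, 0 < e t) (hanti : Antitone e) (hlim : Tendsto e atTop (𝓝 0)) :
    ∃ p : ℕ → ℝ, Tendsto p atTop (𝓝 p₀) ∧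
      ∀ᶠ t in atTop, p t * φ (p t, p (t + 1), e t) = g * (p (t + 1) + D) := by
  obtain ⟨C, hC, δ, hδ, hlip⟩ := exists_lipschitz_of_const hφ h0 one_pos
  obtain ⟨V, hV, hVc⟩ : ∃ V ∈ 𝓝 ((p₀, p₀, 0) : ℝ × ℝ × ℝ), ContinuousOn φ V := by
    obtain ⟨V, hV, h⟩ := hφ.contDiffOn (m := 1) le_rfl (by simp)
    exact ⟨V, by simpa using hV, h.continuousOn⟩
  obtain ⟨δ', hδ', hball⟩ := Metric.mem_nhds_iff.1 hV
  -- The half-width M e_t is chosen so that the drift (m₀ - g) M exceeds the perturbation p₀ C by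
  -- exactly 1; that surplus absorbs the second-order term M C e_t.
  set M := (p₀ * C + 1) / (m₀ - g) with hM
  have hMpos : 0 < M := by
    have : 0 < m₀ - g := by linarith
    positivity
  have hMeq : (m₀ - g) * M = p₀ * C + 1 := by
    rw [hM]
    field_simp [(by linarith : m₀ - g ≠ 0)]
  have ev : ∀ c : ℝ, ∀ d > 0, ∀ᶠ t in atTop, c * e t < d := fun c d hd => by
    have : Tendsto (fun t => c * e t) atTop (𝓝 0) := by simpa using hlim.const_mul c
    exact this.eventually_lt_const hd
  -- From T on, all arguments lie in the Lipschitz and continuity neighbourhoods, the left endpoint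
  -- p₀ - M e_t is positive, and M C e_t < 1.
  obtain ⟨T, hT⟩ := eventually_atTop.1 ((ev 1 δ hδ).and ((ev 1 δ' hδ').and
    ((ev M δ hδ).and ((ev M δ' hδ').and ((ev M p₀ hp₀).and (ev (M * C) 1 one_pos))))))
  have hdist : ∀ t, T ≤ t → ∀ p ∈ Set.Icc (p₀ - M * e t) (p₀ + M * e t),
      |p - p₀| ≤ M * e t := fun t _ p hp => abs_le.2 ⟨by linarith [hp.1], by linarith [hp.2]⟩
  have hle : ∀ t, M * e (t + 1) ≤ M * e t := fun t =>
    mul_le_mul_of_nonneg_left (hanti (Nat.le_succ t)) hMpos.le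
  have hmemV : ∀ t, T ≤ t → ∀ p ∈ Set.Icc (p₀ - M * e t) (p₀ + M * e t),
      ∀ q ∈ Set.Icc (p₀ - M * e (t + 1)) (p₀ + M * e (t + 1)), (p, q, e t) ∈ V := by
    intro t ht p hp q hq
    apply hball
    obtain ⟨-, h2, -, h4, -⟩ := hT t ht
    have hp' := hdist t ht p hp
    have hq' := hdist (t + 1) (by omega) q hq
    simp only [Metric.mem_ball, Prod.dist_eq, Real.dist_eq, sub_zero, abs_of_pos (he t)]
    exact max_lt (by linarith) (max_lt (by linarith [hle t]) (by linarith))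
  have hbound : ∀ t, T ≤ t → ∀ p ∈ Set.Icc (p₀ - M * e t) (p₀ + M * e t),
      ∀ q ∈ Set.Icc (p₀ - M * e (t + 1)) (p₀ + M * e (t + 1)),
      |φ (p, q, e t) - m₀| ≤ C * e t := by
    intro t ht p hp q hq
    obtain ⟨h1, -, h3, -⟩ := hT t ht
    have hp' := hdist t ht p hp
    have hq' := hdist (t + 1) (by omega) q hq
    have := (hlip p q p q (e t) (by linarith) (by linarith [hle t]) (by linarith)
      (by linarith [hle t]) (by rw [abs_of_pos (he t)]; linarith)).2
    rwa [abs_of_pos (he t)] at this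
  have hcont : ∀ t, T ≤ t → ContinuousOn (fun x : ℝ × ℝ => φ (x.1, x.2, e t))
      (Set.Icc (p₀ - M * e t) (p₀ + M * e t) ×ˢ
        Set.Icc (p₀ - M * e (t + 1)) (p₀ + M * e (t + 1))) := fun t ht =>
    hVc.comp (Continuous.continuousOn (by fun_prop)) fun x hx => hmemV t ht _ hx.1 _ hx.2
  have hnn : ∀ t, 0 ≤ M * e t := fun t => (mul_pos hMpos (he t)).le
  obtain ⟨p, hp⟩ := exists_seq_of_backward
    (E := fun t p q => p * φ (p, q, e (T + t)) = g * (q + D))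
    (l := fun t => p₀ - M * e (T + t)) (u := fun t => p₀ + M * e (T + t))
    (fun t => by linarith [hnn (T + t)])
    (fun t => by
      have hc := hcont (T + t) (by omega)
      have := ContinuousOn.preimage_isClosed_of_isClosed
        (f := fun x : ℝ × ℝ => x.1 * φ (x.1, x.2, e (T + t)) - g * (x.2 + D))
        ((continuous_fst.continuousOn.mul hc).sub (Continuous.continuousOn (by fun_prop)))
        (isClosed_Icc.prod isClosed_Icc) (isClosed_singleton (x := (0 : ℝ)))
      convert this using 1
      ext x
      simp only [Set.mem_ofPred_eq, Set.mem_inter_iff, Set.mem_prod, Set.mem_preimage,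
        Set.mem_singleton_iff, sub_eq_zero, and_assoc, add_assoc])
    (fun t q hq => by
      set s := T + t
      have hs : T ≤ s := by omega
      have hq : q ∈ Set.Icc (p₀ - M * e (s + 1)) (p₀ + M * e (s + 1)) := hq
      obtain ⟨-, -, -, -, h5, h6⟩ := hT s hs
      have hes := he s
      have hc : ContinuousOn (fun p => p * φ (p, q, e s) - g * (q + D))
          (Set.Icc (p₀ - M * e s) (p₀ + M * e s)) :=
        (continuousOn_id.mul ((hcont s hs).comp (f := fun p : ℝ => (p, q))
          (Continuous.continuousOn (by fun_prop)) fun p hp => ⟨hp, hq⟩)).sub continuousOn_const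
      have hlu : p₀ - M * e s ≤ p₀ + M * e s := by linarith [hnn s]
      have hlo := abs_le.1 (hbound s hs _ (Set.left_mem_Icc.2 hlu) q hq)
      have hhi := abs_le.1 (hbound s hs _ (Set.right_mem_Icc.2 hlu) q hq)
      -- The intervals shrink in time, so q also lies in the wider interval of date s; the endpoint
      -- signs for the intermediate value theorem follow.
      have hq1 : g * (p₀ - M * e s) ≤ g * q :=
        mul_le_mul_of_nonneg_left (by linarith [hq.1, hle s]) hg.le
      have hq2 : g * q ≤ g * (p₀ + M * e s) :=
        mul_le_mul_of_nonneg_left (by linarith [hq.2, hle s]) hg.le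
      have hlow : (p₀ - M * e s) * φ (p₀ - M * e s, q, e s) - g * (q + D) ≤ 0 := by
        have h1 : (p₀ - M * e s) * φ (p₀ - M * e s, q, e s) ≤ (p₀ - M * e s) * (m₀ + C * e s) :=
          mul_le_mul_of_nonneg_left (by linarith [hlo.2]) (by linarith)
        have h2 : (p₀ - M * e s) * (m₀ + C * e s) - g * (p₀ - M * e s + D)
            = -(e s * (((m₀ - g) * M) - p₀ * C + M * C * e s)) + (m₀ * p₀ - g * (p₀ + D)) := by
          ring
        rw [hMeq, hss] at h2
        have h3 : 0 ≤ e s * (p₀ * C + 1 - p₀ * C + M * C * e s) := by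
          have : 0 < p₀ * C + 1 - p₀ * C + M * C * e s := by
            have : 0 < M * C * e s := by positivity
            linarith
          positivity
        linarith
      have hhigh : 0 ≤ (p₀ + M * e s) * φ (p₀ + M * e s, q, e s) - g * (q + D) := by
        have h1 : (p₀ + M * e s) * (m₀ - C * e s) ≤ (p₀ + M * e s) * φ (p₀ + M * e s, q, e s) :=
          mul_le_mul_of_nonneg_left (by linarith [hhi.1]) (by linarith [hnn s])
        have h2 : (p₀ + M * e s) * (m₀ - C * e s) - g * (p₀ + M * e s + D)
            = e s * (((m₀ - g) * M) - p₀ * C - M * C * e s) + (m₀ * p₀ - g * (p₀ + D)) := by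
          ring
        rw [hMeq, hss] at h2
        have h3 : 0 ≤ e s * (p₀ * C + 1 - p₀ * C - M * C * e s) := by
          have : 0 < p₀ * C + 1 - p₀ * C - M * C * e s := by linarith
          positivity
        linarith
      obtain ⟨p, hp, hpe⟩ := intermediate_value_Icc hlu hc ⟨hlow, hhigh⟩
      exact ⟨p, hp, by simpa [sub_eq_zero] using hpe⟩)
  -- Truncated subtraction fills the dates before T with `p 0`; only the tail matters here.
  refine ⟨fun t => p (t - T), ?_, ?_⟩
  · have hM0 : Tendsto (fun t => M * e t) atTop (𝓝 0) := by simpa using hlim.const_mul M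
    refine tendsto_of_tendsto_of_tendsto_of_le_of_le'
      (g := fun t => p₀ - M * e t) (h := fun t => p₀ + M * e t)
      (by simpa using hM0.const_sub p₀) (by simpa using hM0.const_add p₀) ?_ ?_
    · filter_upwards [eventually_ge_atTop T] with t ht
      simpa [Nat.add_sub_cancel' ht] using (hp (t - T)).1.1
    · filter_upwards [eventually_ge_atTop T] with t ht
      simpa [Nat.add_sub_cancel' ht] using (hp (t - T)).1.2
  · filter_upwards [eventually_ge_atTop T] with t ht
    have := (hp (t - T)).2
    rwa [Nat.add_sub_cancel' ht, ← Nat.sub_add_comm ht] at this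

/-- Solutions converging to the steady state `p₀` agree eventually. -/
lemma eventually_eq_of_solution
    (hφ : ContDiffAt ℝ 1 φ (p₀, p₀, 0)) (h0 : ∀ p q, φ (p, q, 0) = m₀)
    (hp₀ : 0 < p₀) (hg : 0 < g) (hgm : g < m₀)
    (hlim : Tendsto e atTop (𝓝 0)) {p p' : ℕ → ℝ}
    (hp : Tendsto p atTop (𝓝 p₀)) (hp' : Tendsto p' atTop (𝓝 p₀))
    (hsol : ∀ᶠ t in atTop, p t * φ (p t, p (t + 1), e t) = g * (p (t + 1) + D))
    (hsol' : ∀ᶠ t in atTop, p' t * φ (p' t, p' (t + 1), e t) = g * (p' (t + 1) + D)) :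
    ∀ᶠ t in atTop, p t = p' t := by
  -- The spectral gap is split in three: one κ for the deviation of φ from m₀, one for the Lipschitz
  -- term (as p' < 2 p₀), and one left over. Hence A (g + 2κ) ≤ g B + κ (A + B), so A ≤ B.
  set κ := (m₀ - g) / 3
  have hκ : 0 < κ := by simp only [κ]; linarith
  have hκ3 : m₀ = g + 3 * κ := by simp only [κ]; ring
  obtain ⟨C, hC, δ, hδ, hlip⟩ :=
    exists_lipschitz_of_const hφ h0 (ε := κ / (2 * p₀)) (by positivity)
  have hnear : ∀ {r : ℕ → ℝ}, Tendsto r atTop (𝓝 p₀) → ∀ᶠ t in atTop, |r t - p₀| < δ :=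
    fun hr => by simpa [Real.dist_eq] using hr.eventually (Metric.ball_mem_nhds p₀ hδ)
  have he1 : ∀ᶠ t in atTop, |e t| < δ := by
    simpa [Real.dist_eq] using hlim.eventually (Metric.ball_mem_nhds 0 hδ)
  have he2 : ∀ᶠ t in atTop, C * |e t| < κ := by
    have : Tendsto (fun t => C * |e t|) atTop (𝓝 0) := by simpa using hlim.abs.const_mul C
    exact this.eventually_lt_const hκ
  have hpos : ∀ᶠ t in atTop, 0 < p' t := hp'.eventually_const_lt hp₀
  have hbd : ∀ᶠ t in atTop, p' t < 2 * p₀ := hp'.eventually_lt_const (by linarith)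
  have hstep : ∀ᶠ t in atTop, |p t - p' t| ≤ |p (t + 1) - p' (t + 1)| := by
    have sh := tendsto_add_atTop_nat 1
    filter_upwards [hsol, hsol', hnear hp, hnear hp', hnear (hp.comp sh), hnear (hp'.comp sh),
      he1, he2, hpos, hbd] with t h1 h2 h3 h4 h5 h6 h7 h8 h9 h10
    simp only [Function.comp_apply] at h5 h6
    obtain ⟨hl, hm⟩ := hlip (p t) (p (t + 1)) (p' t) (p' (t + 1)) (e t) h3 h5 h4 h6 h7
    set A := |p t - p' t|
    set B := |p (t + 1) - p' (t + 1)|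
    have hA : 0 ≤ A := abs_nonneg _
    have hB : 0 ≤ B := abs_nonneg _
    set f := φ (p t, p (t + 1), e t)
    set f' := φ (p' t, p' (t + 1), e t)
    have hf : g + 2 * κ ≤ f := by have := (abs_le.1 hm).1; linarith
    have heq : (p t - p' t) * f = g * (p (t + 1) - p' (t + 1)) - p' t * (f - f') := by
      linarith
    have h11 : A * f ≤ g * B + p' t * |f - f'| := by
      have : |(p t - p' t) * f| = A * f := by rw [abs_mul, abs_of_pos (by linarith : 0 < f)]
      rw [← this, heq]
      refine (abs_sub _ _).trans (le_of_eq ?_)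
      rw [abs_mul, abs_mul, abs_of_pos hg, abs_of_pos h9]
    have h12 : p' t * |f - f'| ≤ κ * (A + B) := by
      calc p' t * |f - f'| ≤ (2 * p₀) * (κ / (2 * p₀) * (A + B)) := by gcongr
        _ = κ * (A + B) := by field_simp
    have h13 : A * (g + 2 * κ) ≤ A * f := by gcongr
    have h14 : A * (g + κ) ≤ B * (g + κ) := by linarith
    exact le_of_mul_le_mul_right h14 (by linarith)
  obtain ⟨T, hT⟩ := eventually_atTop.1 hstep
  filter_upwards [eventually_ge_atTop T] with t ht
  -- The gap is nondecreasing along the tail and tends to 0, hence is 0.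
  have hmono : ∀ k, |p t - p' t| ≤ |p (k + t) - p' (k + t)| := by
    intro k
    induction k with
    | zero => simp
    | succ k ih => exact ih.trans (by simpa [add_right_comm] using hT (k + t) (by omega))
  have hz : Tendsto (fun k => |p (k + t) - p' (k + t)|) atTop (𝓝 0) := by
    simpa [Function.comp_def] using ((hp.sub hp').abs).comp (tendsto_add_atTop_nat t)
  have := ge_of_tendsto' hz hmono
  exact sub_eq_zero.1 (abs_nonpos_iff.1 this)

end Dynamics

/-! ### One backward step at a fixed date -/

section Backward

variable {U : ℝ → ℝ → ℝ}

/-- The current detrended price that supports a given continuation value `S` exists. -/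
lemma RegularUtility.exists_backward (hU : RegularUtility U) {a c S e : ℝ} (ha : 0 < a)
    (hc : 0 < c) (hS : 0 < S) (he : 0 < e) :
    ∃ p, 0 < p ∧ 0 < a - p * e ∧ p * mrs U 1 (c / (a - p * e)) = S := by
  obtain ⟨w, hw, hwm⟩ := hU.exists_le_mrs (S / (a / (2 * e)))
  have hae : 0 < a / (2 * e) := by positivity
  have hae' : a / (2 * e) * e = a / 2 := by field_simp
  have hm := hU.mrs_pos one_pos (show 0 < 2 * c / a by positivity)
  -- At `l` young consumption is at least a/2, so the ratio is at most 2c/a. At `u` it is at most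
  -- c/w, so the ratio is at least w, where the marginal rate is already large enough.
  set l := min (a / (2 * e)) (S / mrs U 1 (2 * c / a))
  set u := max (a / (2 * e)) ((a - c / w) / e)
  have hl : 0 < l := lt_min hae (div_pos hS hm)
  have hlu : l ≤ u := (min_le_left _ _).trans (le_max_left _ _)
  have hu : 0 < a - u * e := by
    have : u < a / e := by
      refine max_lt ?_ ?_
      · rw [div_lt_div_iff₀ (by positivity) he]
        nlinarith [mul_pos ha he]
      · have : 0 < c / w := by positivity
        gcongr
        linarith
    rw [lt_div_iff₀ he] at this
    linarith
  have hpos : ∀ p ∈ Set.Icc l u, 0 < a - p * e := fun p hp => by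
    have := mul_le_mul_of_nonneg_right hp.2 he.le
    linarith
  have hcont : ContinuousOn (fun p => p * mrs U 1 (c / (a - p * e))) (Set.Icc l u) := by
    refine continuousOn_id.mul (hU.contDiffOn_mrs.continuousOn.comp
      (f := fun p => c / (a - p * e)) ?_ fun p hp => div_pos hc (hpos p hp))
    exact continuousOn_const.div (Continuous.continuousOn (by fun_prop))
      fun p hp => (hpos p hp).ne'
  have hlow : l * mrs U 1 (c / (a - l * e)) ≤ S := by
    have h1 : l * e ≤ a / 2 := by
      rw [← hae']
      exact mul_le_mul_of_nonneg_right (min_le_left _ _) he.le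
    have h2 : c / (a - l * e) ≤ 2 * c / a := by
      rw [div_le_div_iff₀ (by linarith) ha]
      nlinarith
    have h3 : mrs U 1 (c / (a - l * e)) ≤ mrs U 1 (2 * c / a) :=
      hU.mrs_strictMonoOn.monotoneOn (div_pos hc (by linarith))
        (show 0 < 2 * c / a by positivity) h2
    calc l * mrs U 1 (c / (a - l * e)) ≤ S / mrs U 1 (2 * c / a) * mrs U 1 (2 * c / a) := by
          have := hU.mrs_pos one_pos (div_pos hc (show 0 < a - l * e by linarith))
          gcongr
          exact min_le_right _ _
      _ = S := by field_simp
  have hhigh : S ≤ u * mrs U 1 (c / (a - u * e)) := by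
    have h1 : a - u * e ≤ c / w := by
      have := mul_le_mul_of_nonneg_right (le_max_right (a / (2 * e)) ((a - c / w) / e)) he.le
      rw [div_mul_cancel₀ _ he.ne'] at this
      linarith
    have h2 : w ≤ c / (a - u * e) := by
      rw [le_div_iff₀ hw] at h1
      rw [le_div_iff₀ hu]
      linarith
    have h3 : mrs U 1 w ≤ mrs U 1 (c / (a - u * e)) :=
      hU.mrs_strictMonoOn.monotoneOn hw (div_pos hc hu) h2
    calc S = a / (2 * e) * (S / (a / (2 * e))) := by field_simp
      _ ≤ u * mrs U 1 (c / (a - u * e)) :=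
        mul_le_mul (le_max_left _ _) (hwm.trans h3) (by positivity) (hl.le.trans hlu)
  obtain ⟨p, hp, hpS⟩ := intermediate_value_Icc hlu hcont ⟨hlow, hhigh⟩
  exact ⟨p, hl.trans_le hp.1, hpos p hp, hpS⟩

/-- The current detrended price that supports a given continuation value is unique. -/
lemma RegularUtility.backward_unique (hU : RegularUtility U) {a c e p p' : ℝ}
    (hc : 0 < c) (he : 0 < e) (hp : 0 < p) (hp' : 0 < p') (hy : 0 < a - p * e)
    (hy' : 0 < a - p' * e)
    (h : p * mrs U 1 (c / (a - p * e)) = p' * mrs U 1 (c / (a - p' * e))) : p = p' := by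
  have key : ∀ {s t : ℝ}, 0 < s → 0 < a - s * e → 0 < a - t * e → s < t →
      s * mrs U 1 (c / (a - s * e)) < t * mrs U 1 (c / (a - t * e)) := by
    intro s t hs hys hyt hst
    have h1 : s * e < t * e := mul_lt_mul_of_pos_right hst he
    have h2 : c / (a - s * e) < c / (a - t * e) := by gcongr
    have h3 := hU.mrs_strictMonoOn (div_pos hc hys) (div_pos hc hyt) h2
    exact mul_lt_mul'' hst h3 hs.le (hU.mrs_pos one_pos (div_pos hc hys)).le
  rcases lt_trichotomy p p' with hlt | rfl | hlt
  · exact absurd h (key hp hy hy' hlt).ne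
  · rfl
  · exact absurd h (key hp' hy' hy hlt).ne'

end Backward

/-! ### Steady states and paths -/

/-- `p` is a sequence of detrended prices satisfying the first-order condition at date `t`. -/
def PriceStep (U : ℝ → ℝ → ℝ) (a b D G Gd : ℝ) (p : ℕ → ℝ) (t : ℕ) : Prop :=
  0 < p t ∧ 0 < a - p t * (Gd / G) ^ t ∧
    p t * mrs U 1 ((G * b + Gd * (p (t + 1) + D) * (Gd / G) ^ t) / (a - p t * (Gd / G) ^ t)) =
      Gd * (p (t + 1) + D)

section Paths

variable {U : ℝ → ℝ → ℝ} {a b D G Gd : ℝ}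

lemma foc_iff (hU : RegularUtility U) {y z p S : ℝ} (hy : 0 < y) (hz : 0 < z) :
    S * Uz U y z - p * Uy U y z = 0 ↔ p * mrs U 1 (z / y) = S := by
  rw [← hU.mrs_eq hy hz, mrs, mul_div_assoc', div_eq_iff (hU.Uz_pos y z hy hz).ne', sub_eq_zero]
  exact eq_comm

lemma oldArg_pos (hGd : 0 < Gd) (hG : 0 < G) (hb : 0 ≤ b) (hD : 0 < D) {q e : ℝ} (hq : 0 < q)
    (he : 0 < e) : 0 < G * b + Gd * (q + D) * e := by positivity

lemma isPath_iff (hU : RegularUtility U) (hGd : 0 < Gd) (hG : 0 < G) (hb : 0 ≤ b) (hD : 0 < D)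
    {ξ : ℕ → ℝ × ℝ} :
    IsPath U a b D G Gd ξ ↔
      (∀ t, (ξ t).2 = (Gd / G) ^ t) ∧ ∀ t, PriceStep U a b D G Gd (fun s => (ξ s).1) t := by
  have hr : ∀ t : ℕ, 0 < (Gd / G) ^ t := fun t => by positivity
  constructor
  · intro h
    refine ⟨fun t => (h t).2.1, fun t => ?_⟩
    obtain ⟨hp, he, hy, hz, hΦ⟩ := h t
    have h1 := (Prod.ext_iff.1 hΦ).1
    simp only [youngArg, oldArg, Phi, he, Prod.fst_zero] at hy hz h1
    exact ⟨hp, hy, (foc_iff hU hy hz).1 h1⟩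
  · rintro ⟨he, h⟩ t
    obtain ⟨hp, hy, h1⟩ := h t
    have hz := oldArg_pos hGd hG hb hD (h (t + 1)).1 (hr t)
    refine ⟨hp, he t, ?_, ?_, Prod.ext ?_ ?_⟩
    · simpa only [youngArg, he] using hy
    · simpa only [oldArg, he] using hz
    · simpa only [youngArg, oldArg, Phi, he, Prod.fst_zero] using (foc_iff hU hy hz).2 h1
    · simp only [Phi, he, Prod.snd_zero]
      ring

/-- The second equation is ξ₂ (1 - G_d/G) = 0, so ξ₂ = 0; positive old-age consumption then means b
> 0. -/
lemma isSteadyState_iff (hU : RegularUtility U) (hGd : 0 < Gd) (hGdG : Gd < G) (ha : 0 < a)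
    {ξ : ℝ × ℝ} :
    IsSteadyState U a b D G Gd ξ ↔
      ξ.2 = 0 ∧ 0 < b ∧ 0 < ξ.1 ∧ ξ.1 * mrs U 1 (G * b / a) = Gd * (ξ.1 + D) := by
  have hG : 0 < G := hGd.trans hGdG
  constructor
  · rintro ⟨hp, hy, hz, hΦ⟩
    have h2 := (Prod.ext_iff.1 hΦ).2
    have h1 := (Prod.ext_iff.1 hΦ).1
    simp only [Phi, Prod.fst_zero, Prod.snd_zero] at h1 h2
    have h0 : ξ.2 = 0 := by
      have h3 : ξ.2 * (1 - Gd / G) = 0 := by linarith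
      have h4 : Gd / G < 1 := (div_lt_one hG).2 hGdG
      exact (mul_eq_zero.1 h3).resolve_right (by linarith)
    simp only [youngArg, oldArg, h0, mul_zero, sub_zero, add_zero] at h1 hz
    exact ⟨h0, pos_of_mul_pos_right hz hG.le, hp, (foc_iff hU ha hz).1 h1⟩
  · rintro ⟨h0, hb, hp, h1⟩
    have hz : 0 < G * b := by positivity
    refine ⟨hp, ?_, ?_, Prod.ext ?_ ?_⟩
    · simpa only [youngArg, h0, mul_zero, sub_zero] using ha
    · simpa only [oldArg, h0, mul_zero, add_zero] using hz
    · simpa only [Phi, youngArg, oldArg, h0, mul_zero, sub_zero, add_zero, Prod.fst_zero] using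
        (foc_iff hU ha hz).2 h1
    · simp [Phi, h0]

/-- At e = 0 the ratio equals Gb/a, which b > 0 places inside the domain of smoothness. -/
lemma contDiffAt_mrs_args (hU : RegularUtility U) (hG : 0 < G) (ha : 0 < a) (hb : 0 < b)
    (p₀ : ℝ) :
    ContDiffAt ℝ 1 (fun x : ℝ × ℝ × ℝ =>
      mrs U 1 ((G * b + Gd * (x.2.1 + D) * x.2.2) / (a - x.1 * x.2.2))) (p₀, p₀, 0) := by
  have hm : ContDiffAt ℝ 1 (fun w => mrs U 1 w) (G * b / a) :=
    hU.contDiffOn_mrs.contDiffAt (Ioi_mem_nhds (by positivity))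
  have hW : ContDiffAt ℝ 1 (fun x : ℝ × ℝ × ℝ =>
      (G * b + Gd * (x.2.1 + D) * x.2.2) / (a - x.1 * x.2.2)) (p₀, p₀, 0) :=
    ContDiffAt.div (by fun_prop) (by fun_prop) (by simpa using ha.ne')
  exact ContDiffAt.comp (g := fun w => mrs U 1 w) _ (by simpa using hm) hW

variable {p₀ : ℝ}

lemma exists_priceStep_tendsto (hU : RegularUtility U) (hGd : 0 < Gd) (hGdG : Gd < G)
    (ha : 0 < a) (hb : 0 < b) (hD : 0 < D) (hm : Gd < mrs U 1 (G * b / a)) (hp₀ : 0 < p₀)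
    (hss : p₀ * mrs U 1 (G * b / a) = Gd * (p₀ + D)) :
    ∃ p : ℕ → ℝ, (∀ t, PriceStep U a b D G Gd p t) ∧ Tendsto p atTop (𝓝 p₀) := by
  have hG : 0 < G := hGd.trans hGdG
  have hr0 : 0 < Gd / G := by positivity
  have hr1 : Gd / G < 1 := (div_lt_one hG).2 hGdG
  have hlim := tendsto_pow_atTop_nhds_zero_of_lt_one hr0.le hr1
  obtain ⟨p, hp, hev⟩ := exists_eventual_solution (D := D) (g := Gd)
    (contDiffAt_mrs_args hU hG ha hb p₀) (m₀ := mrs U 1 (G * b / a)) (by simp) hp₀ hGd hm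
    (by linarith) (fun t => pow_pos hr0 t) (pow_right_anti₀ hr0.le hr1.le) hlim
  have hyoung : ∀ᶠ t in atTop, 0 < a - p t * (Gd / G) ^ t := by
    have : Tendsto (fun t => a - p t * (Gd / G) ^ t) atTop (𝓝 a) := by
      simpa using (hp.mul hlim).const_sub a
    exact this.eventually_const_lt ha
  obtain ⟨T, hT⟩ := eventually_atTop.1 ((hp.eventually_const_lt hp₀).and (hyoung.and hev))
  -- Downward induction on the starting date: each step overwrites a single entry, which leaves the
  -- limit unchanged.
  suffices ∀ T (p : ℕ → ℝ), Tendsto p atTop (𝓝 p₀) → (∀ t ≥ T, PriceStep U a b D G Gd p t) →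
      ∃ p : ℕ → ℝ, (∀ t, PriceStep U a b D G Gd p t) ∧ Tendsto p atTop (𝓝 p₀) from
    this T p hp hT
  intro T
  induction T with
  | zero => exact fun p hp h => ⟨p, fun t => h t (Nat.zero_le t), hp⟩
  | succ T ih =>
    intro p hp h
    have hq : 0 < p (T + 1) := (h (T + 1) le_rfl).1
    obtain ⟨v, hv, hy, hvS⟩ := hU.exists_backward ha
      (oldArg_pos hGd hG hb.le hD hq (pow_pos hr0 T))
      (show 0 < Gd * (p (T + 1) + D) by positivity) (pow_pos hr0 T)
    refine ih (Function.update p T v) (hp.congr' ?_) fun t ht => ?_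
    · filter_upwards [eventually_gt_atTop T] with t ht
      rw [Function.update_of_ne (by omega)]
    · rw [PriceStep, Function.update_of_ne (by omega : t + 1 ≠ T)]
      rcases eq_or_ne t T with rfl | hne
      · rw [Function.update_self]
        exact ⟨hv, hy, hvS⟩
      · rw [Function.update_of_ne hne]
        exact h t (by omega)

lemma priceStep_unique (hU : RegularUtility U) (hGd : 0 < Gd) (hGdG : Gd < G)
    (ha : 0 < a) (hb : 0 < b) (hD : 0 < D) (hm : Gd < mrs U 1 (G * b / a)) (hp₀ : 0 < p₀)
    {p p' : ℕ → ℝ}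
    (h : ∀ t, PriceStep U a b D G Gd p t) (hp : Tendsto p atTop (𝓝 p₀))
    (h' : ∀ t, PriceStep U a b D G Gd p' t) (hp' : Tendsto p' atTop (𝓝 p₀)) : p = p' := by
  have hG : 0 < G := hGd.trans hGdG
  have hr0 : 0 < Gd / G := by positivity
  have hr1 : Gd / G < 1 := (div_lt_one hG).2 hGdG
  have hlim := tendsto_pow_atTop_nhds_zero_of_lt_one hr0.le hr1
  have hev := eventually_eq_of_solution (D := D) (g := Gd)
    (contDiffAt_mrs_args hU hG ha hb p₀) (m₀ := mrs U 1 (G * b / a)) (by simp) hp₀ hGd hm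
    hlim hp hp' (Eventually.of_forall fun t => (h t).2.2)
    (Eventually.of_forall fun t => (h' t).2.2)
  obtain ⟨T, hT⟩ := eventually_atTop.1 hev
  suffices ∀ T, (∀ t ≥ T, p t = p' t) → p = p' from this T hT
  intro T
  induction T with
  | zero => exact fun hT => funext fun t => hT t (Nat.zero_le t)
  | succ T ih =>
    intro hT
    refine ih fun t ht => ?_
    rcases eq_or_lt_of_le ht with rfl | hlt
    · obtain ⟨h1, h2, h3⟩ := h T
      obtain ⟨h1', h2', h3'⟩ := h' T
      rw [← hT (T + 1) le_rfl] at h3'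
      exact hU.backward_unique
        (oldArg_pos hGd hG hb.le hD (h (T + 1)).1 (pow_pos hr0 T)) (pow_pos hr0 T)
        h1 h1' h2 h2' (h3.trans h3'.symm)
    · exact hT t hlt

end Paths

/-! ### Equilibrium prices and first-order conditions -/

section Equilibrium

variable {U : ℝ → ℝ → ℝ} {a b D G Gd : ℝ}

lemma scaled_young (hGd : 0 < Gd) (hG : 0 < G) (P : ℕ → ℝ) (t : ℕ) :
    geo a G t - P t = G ^ t * (a - P t / Gd ^ t * (Gd / G) ^ t) := by
  rw [geo, div_pow]
  field_simp

lemma scaled_old (hGd : 0 < Gd) (hG : 0 < G) (P : ℕ → ℝ) (t : ℕ) :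
    geo b G (t + 1) + (P (t + 1) + geo D Gd (t + 1)) =
      G ^ t * (G * b + Gd * (P (t + 1) / Gd ^ (t + 1) + D) * (Gd / G) ^ t) := by
  rw [geo, geo, div_pow, pow_succ, pow_succ]
  field_simp

lemma scaled_foc (hU : RegularUtility U) (hGd : 0 < Gd) (hG : 0 < G) (P : ℕ → ℝ) (t : ℕ)
    (hy : 0 < geo a G t - P t) (hz : 0 < geo b G (t + 1) + (P (t + 1) + geo D Gd (t + 1))) :
    (P (t + 1) + geo D Gd (t + 1)) *
          Uz U (geo a G t - P t) (geo b G (t + 1) + (P (t + 1) + geo D Gd (t + 1)))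
        - P t * Uy U (geo a G t - P t) (geo b G (t + 1) + (P (t + 1) + geo D Gd (t + 1))) = 0 ↔
      P t / Gd ^ t * mrs U 1 ((G * b + Gd * (P (t + 1) / Gd ^ (t + 1) + D) * (Gd / G) ^ t) /
        (a - P t / Gd ^ t * (Gd / G) ^ t)) = Gd * (P (t + 1) / Gd ^ (t + 1) + D) := by
  rw [foc_iff hU hy hz, scaled_young hGd hG, scaled_old hGd hG,
    mul_div_mul_left _ _ (pow_pos hG t).ne']
  have h : P (t + 1) + geo D Gd (t + 1) = Gd ^ t * (Gd * (P (t + 1) / Gd ^ (t + 1) + D)) := by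
    rw [geo, pow_succ]
    field_simp
  rw [h]
  generalize mrs U 1 _ = m
  rw [div_mul_eq_mul_div, div_eq_iff (pow_pos hGd t).ne', mul_comm (Gd ^ t)]

/-- Necessity: one share is an interior maximum along the budget line. Sufficiency: the supporting
hyperplane at the chosen bundle, with Euler's identity, dominates every affordable alternative. -/
lemma isEquilibriumPrice_iff (hU : RegularUtility U) (hGd : 0 < Gd) (hG : 0 < G) (hb : 0 ≤ b)
    (hD : 0 < D) {P : ℕ → ℝ} :
    IsEquilibriumPrice U (geo a G) (geo b G) (geo D Gd) P ↔
      ∀ t, PriceStep U a b D G Gd (fun s => P s / Gd ^ s) t := by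
  constructor
  · rintro ⟨x, y, z, h⟩ t
    have hP := h.price_pos t
    have hyt : y t = geo a G t - P t := by
      have := h.budget_young t
      rw [h.asset_clear, mul_one] at this
      linarith
    have hzt : z (t + 1) = geo b G (t + 1) + (P (t + 1) + geo D Gd (t + 1)) := by
      rw [h.budget_old, h.asset_clear, mul_one]
    have hy := h.young_pos t
    have hz := h.old_pos t
    rw [hyt] at hy
    rw [hzt] at hz
    refine ⟨by positivity, ?_, ?_⟩
    · rw [scaled_young hGd hG] at hy
      exact pos_of_mul_pos_right hy (by positivity)
    · refine (scaled_foc hU hGd hG P t hy hz).1 ?_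
      have hder := hU.hasDerivAt_line (α := geo a G t) (β := -P t) (γ := geo b G (t + 1))
        (δ := P (t + 1) + geo D Gd (t + 1)) (x := 1) (by linarith) (by linarith)
      have hc1 : ContinuousAt (fun s => geo a G t + -P t * s) 1 := by fun_prop
      have hc2 : ContinuousAt
          (fun s => geo b G (t + 1) + (P (t + 1) + geo D Gd (t + 1)) * s) 1 := by fun_prop
      have hmax : IsLocalMax (fun s => U (geo a G t + -P t * s)
          (geo b G (t + 1) + (P (t + 1) + geo D Gd (t + 1)) * s)) 1 := by
        filter_upwards [hc1.eventually_const_lt (by linarith : 0 < geo a G t + -P t * 1),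
          hc2.eventually_const_lt
            (by linarith : 0 < geo b G (t + 1) + (P (t + 1) + geo D Gd (t + 1)) * 1)]
          with s hs1 hs2
        have := h.optimal t s (by linarith) hs2
        rw [hyt, hzt] at this
        simpa only [neg_mul, mul_one, ← sub_eq_add_neg] using this
      have h0 := hmax.hasDerivAt_eq_zero hder
      simp only [neg_mul, mul_one, ← sub_eq_add_neg] at h0
      linarith
  · intro h
    have hP : ∀ t, 0 < P t := fun t => by
      have := mul_pos (h t).1 (pow_pos hGd t)
      rwa [div_mul_cancel₀ _ (pow_pos hGd t).ne'] at this
    have hy : ∀ t, 0 < geo a G t - P t := fun t => by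
      rw [scaled_young hGd hG]
      exact mul_pos (pow_pos hG t) (h t).2.1
    have hz : ∀ t, 0 < geo b G (t + 1) + (P (t + 1) + geo D Gd (t + 1)) := fun t => by
      rw [scaled_old hGd hG]
      exact mul_pos (pow_pos hG t)
        (oldArg_pos hGd hG hb hD (h (t + 1)).1 (pow_pos (div_pos hGd hG) t))
    refine ⟨fun _ => 1, fun t => geo a G t - P t, fun t => geo b G t + (P t + geo D Gd t),
      hP, hy, hz, fun t => by ring, fun t => by ring, rfl, fun t x' hy' hz' => ?_,
      fun t => by ring, fun _ => rfl⟩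
    have h1 := (scaled_foc hU hGd hG P t (hy t) (hz t)).2 (h t).2.2
    have h2 := hU.le_support (hy t) (hz t) hy' hz'
    have h3 := hU.euler (hy t) (hz t)
    rw [h3]
    refine h2.trans (le_of_eq ?_)
    -- Along the budget line the supporting functional changes by (x' - 1) times the first-order
    -- expression, which is zero.
    linear_combination (x' - 1) * h1

end Equilibrium

/-! ### Discounted prices and the absence of bubbles -/

section Bubble

variable {P D : ℕ → ℝ}

lemma adPrice_succ_mul (hP : ∀ t, 0 < P t) (hD : ∀ t, 0 < D t) (t : ℕ) :
    adPrice P D (t + 1) * (P (t + 1) + D (t + 1)) = adPrice P D t * P t := by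
  have h1 := (add_pos (hP (t + 1)) (hD (t + 1))).ne'
  have h2 : (P (t + 1) + D (t + 1)) / grossRate P D t = P t := by
    rw [grossRate, div_div_cancel₀ h1]
  rw [adPrice, adPrice, Finset.prod_range_succ, one_div_mul_eq_div, one_div_mul_eq_div,
    mul_comm, ← div_div, h2]

lemma adPrice_pos (hP : ∀ t, 0 < P t) (hD : ∀ t, 0 < D t) (t : ℕ) : 0 < adPrice P D t :=
  one_div_pos.2 <| Finset.prod_pos fun s _ => div_pos (add_pos (hP (s + 1)) (hD (s + 1))) (hP s)

/-- If the price-dividend ratio is bounded, discounted prices vanish asymptotically. -/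
lemma tendsto_adPrice_mul (hP : ∀ t, 0 < P t) (hD : ∀ t, 0 < D t) {K : ℝ}
    (hK : ∀ t, P t ≤ K * D t) : Tendsto (fun t => adPrice P D t * P t) atTop (𝓝 0) := by
  have hK0 : 0 < K := pos_of_mul_pos_left ((hP 0).trans_le (hK 0)) (hD 0).le
  have hpos : ∀ t, 0 < adPrice P D t * P t := fun t => mul_pos (adPrice_pos hP hD t) (hP t)
  -- P ≤ K D gives P ≤ K/(K+1) · (P + D), and the discounted payoff P + D equals the previous
  -- discounted price.
  have hstep : ∀ t, adPrice P D (t + 1) * P (t + 1) ≤ K / (K + 1) * (adPrice P D t * P t) := by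
    intro t
    rw [← adPrice_succ_mul hP hD t, div_mul_eq_mul_div, le_div_iff₀ (by positivity)]
    have := mul_le_mul_of_nonneg_left (hK (t + 1)) (adPrice_pos hP hD (t + 1)).le
    linarith
  have hbound : ∀ t, adPrice P D t * P t ≤ (K / (K + 1)) ^ t * (adPrice P D 0 * P 0) := by
    intro t
    induction t with
    | zero => simp
    | succ t ih =>
      refine (hstep t).trans ?_
      rw [pow_succ', mul_assoc]
      gcongr
  have hρ := tendsto_pow_atTop_nhds_zero_of_lt_one (r := K / (K + 1)) (by positivity)
    ((div_lt_one (by positivity)).2 (by linarith))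
  exact squeeze_zero (fun t => (hpos t).le) hbound (by simpa using hρ.mul_const _)

lemma noBubble_of_bounded (hP : ∀ t, 0 < P t) (hD : ∀ t, 0 < D t) {K : ℝ}
    (hK : ∀ t, P t ≤ K * D t) : NoBubble P D := fun t => by
  simpa using (tendsto_adPrice_mul hP hD hK).const_mul (1 / adPrice P D t)

/-- Each discounted dividend is a difference of consecutive discounted prices; the sum telescopes
and its remainder vanishes. -/
lemma hasSum_adPrice_mul (hP : ∀ t, 0 < P t) (hD : ∀ t, 0 < D t) {K : ℝ}
    (hK : ∀ t, P t ≤ K * D t) (t : ℕ) :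
    HasSum (fun k => adPrice P D (t + 1 + k) * D (t + 1 + k)) (adPrice P D t * P t) := by
  rw [hasSum_iff_tendsto_nat_of_nonneg fun k => (mul_pos (adPrice_pos hP hD _) (hD _)).le]
  have hsum : ∀ n, ∑ k ∈ Finset.range n, adPrice P D (t + 1 + k) * D (t + 1 + k) =
      adPrice P D t * P t - adPrice P D (n + t) * P (n + t) := by
    intro n
    induction n with
    | zero => simp
    | succ n ih =>
      have h := adPrice_succ_mul hP hD (n + t)
      rw [Finset.sum_range_succ, ih, show t + 1 + n = n + t + 1 by omega,
        show n + 1 + t = n + t + 1 by omega]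
      linarith
  simp only [hsum]
  simpa using ((tendsto_add_atTop_iff_nat t).2 (tendsto_adPrice_mul hP hD hK)).const_sub
    (adPrice P D t * P t)

lemma eq_fundamentalValue (hP : ∀ t, 0 < P t) (hD : ∀ t, 0 < D t) {K : ℝ}
    (hK : ∀ t, P t ≤ K * D t) (t : ℕ) : P t = fundamentalValue P D t := by
  rw [fundamentalValue, (hasSum_adPrice_mul hP hD hK t).tsum_eq]
  field_simp [(adPrice_pos hP hD t).ne']

end Bubble

end OLG

/-! ### The proposition -/

theorem mainTheorem3 (U : ℝ → ℝ → ℝ) (hU : OLG.RegularUtility U)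
    (G Gd : ℝ) (hGd : 0 < Gd) (hGdG : Gd < G) :
    ∃ wf : ℝ,
      (0 < wf ∧ OLG.mrs U 1 (G * wf) = Gd) ∧
      (∀ w : ℝ, 0 < w → OLG.mrs U 1 (G * w) = Gd → w = wf) ∧
      ∀ a b D : ℝ, 0 < a → 0 ≤ b → 0 < D →
        ((∃ ξs : ℝ × ℝ, OLG.IsSteadyState U a b D G Gd ξs) ↔ wf < b / a) ∧
        (wf < b / a →
          ∃ ξs : ℝ × ℝ, OLG.IsSteadyState U a b D G Gd ξs ∧
            (∀ ξs' : ℝ × ℝ, OLG.IsSteadyState U a b D G Gd ξs' → ξs' = ξs) ∧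
            ∃ ξ : ℕ → ℝ × ℝ,
              (OLG.IsPath U a b D G Gd ξ ∧ Filter.Tendsto ξ Filter.atTop (nhds ξs)) ∧
              (∀ ξ' : ℕ → ℝ × ℝ, OLG.IsPath U a b D G Gd ξ' →
                Filter.Tendsto ξ' Filter.atTop (nhds ξs) → ξ' = ξ) ∧
              ∃ P : ℕ → ℝ, (∀ t, P t = (ξ t).1 * Gd ^ t) ∧
                OLG.IsEquilibriumPrice U (OLG.geo a G) (OLG.geo b G) (OLG.geo D Gd) P ∧
                (∀ P' : ℕ → ℝ,
                  OLG.IsEquilibriumPrice U (OLG.geo a G) (OLG.geo b G) (OLG.geo D Gd) P' →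
                  Filter.Tendsto (fun t => P' t / Gd ^ t) Filter.atTop (nhds ξs.1) → P' = P) ∧
                Asymptotics.IsEquivalent Filter.atTop P
                  (fun t => Gd * OLG.Uz U a (G * b) / (OLG.Uy U a (G * b)
                    - Gd * OLG.Uz U a (G * b)) * D * Gd ^ t) ∧
                OLG.NoBubble P (OLG.geo D Gd) ∧
                ∀ t, Summable (fun k : ℕ => OLG.adPrice P (OLG.geo D Gd) (t + 1 + k)
                      * OLG.geo D Gd (t + 1 + k)) ∧
                  P t = OLG.fundamentalValue P (OLG.geo D Gd) t) := by
  have hG : 0 < G := hGd.trans hGdG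
  obtain ⟨w, hw, hwm⟩ := hU.exists_mrs_eq hGd
  have hGw : G * (w / G) = w := by field_simp
  refine ⟨w / G, ⟨by positivity, by rw [hGw, hwm]⟩, fun v hv hvm => ?_, ?_⟩
  · have hGv : 0 < G * v := by positivity
    have : G * v = w := hU.mrs_strictMonoOn.injOn hGv hw (hvm.trans hwm.symm)
    rw [← this]
    field_simp
  intro a b D ha hb hD
  have hcond : w / G < b / a ↔ 0 < b ∧ Gd < OLG.mrs U 1 (G * b / a) := by
    have hiff : w / G < b / a ↔ w < G * b / a := by
      rw [div_lt_iff₀ hG, div_mul_eq_mul_div, mul_comm b G]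
    rw [hiff]
    constructor
    · intro h
      have hGb : 0 < G * b / a := hw.trans h
      have hb0 : 0 < b := by
        refine lt_of_le_of_ne hb fun h0 => ?_
        simp [← h0] at hGb
      exact ⟨hb0, hwm ▸ hU.mrs_strictMonoOn hw hGb h⟩
    · rintro ⟨hb0, h⟩
      have hGb : 0 < G * b / a := by positivity
      rw [← hwm] at h
      exact (hU.mrs_strictMonoOn.lt_iff_lt hw hGb).1 h
  have hsteady : ∀ {ξ : ℝ × ℝ}, OLG.IsSteadyState U a b D G Gd ξ ↔ _ :=
    OLG.isSteadyState_iff hU hGd hGdG ha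
  have hexists : w / G < b / a → OLG.IsSteadyState U a b D G Gd
      (Gd * D / (OLG.mrs U 1 (G * b / a) - Gd), 0) := by
    rw [hcond]
    rintro ⟨hb0, hm⟩
    have hm' : 0 < OLG.mrs U 1 (G * b / a) - Gd := by linarith
    refine hsteady.2 ⟨rfl, hb0, by positivity, ?_⟩
    field_simp
    ring
  refine ⟨⟨?_, fun h => ⟨_, hexists h⟩⟩, fun h => ⟨_, hexists h, ?_⟩⟩
  · rintro ⟨ξ, hξ⟩
    obtain ⟨-, hb0, hp, h1⟩ := hsteady.1 hξ
    refine hcond.2 ⟨hb0, lt_of_mul_lt_mul_left ?_ hp.le⟩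
    rw [h1]
    nlinarith [mul_pos hGd hD]
  obtain ⟨hb0, hm⟩ := hcond.1 h
  obtain ⟨-, -, hp₀, hss⟩ := hsteady.1 (hexists h)
  have hm' : 0 < OLG.mrs U 1 (G * b / a) - Gd := by linarith
  have hval : Gd * D / (OLG.mrs U 1 (G * b / a) - Gd) = Gd * OLG.Uz U a (G * b) /
      (OLG.Uy U a (G * b) - Gd * OLG.Uz U a (G * b)) * D := by
    have hGb : 0 < G * b := by positivity
    have hz := hU.Uz_pos a (G * b) ha hGb
    have h2 : OLG.Uy U a (G * b) = OLG.mrs U 1 (G * b / a) * OLG.Uz U a (G * b) := by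
      rw [← hU.mrs_eq ha hGb, OLG.mrs, div_mul_cancel₀ _ hz.ne']
    rw [h2, ← sub_mul, mul_div_mul_right _ _ hz.ne', div_mul_eq_mul_div]
  set p₀ := Gd * D / (OLG.mrs U 1 (G * b / a) - Gd) with hp₀_def
  refine ⟨fun ξ' hξ' => ?_, ?_⟩
  · obtain ⟨h0, -, -, h1⟩ := hsteady.1 hξ'
    refine Prod.ext ?_ h0
    rw [hp₀_def]
    simp only
    rw [eq_div_iff hm'.ne']
    linarith
  obtain ⟨p, hp, hlim⟩ :=
    OLG.exists_priceStep_tendsto hU hGd hGdG ha hb0 hD hm hp₀ hss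
  have hr := tendsto_pow_atTop_nhds_zero_of_lt_one (r := Gd / G) (by positivity)
    ((div_lt_one hG).2 hGdG)
  have hpow : ∀ t : ℕ, 0 < Gd ^ t := fun t => pow_pos hGd t
  have hdetrend : (fun t => p t * Gd ^ t / Gd ^ t) = p := by
    funext t
    rw [mul_div_cancel_right₀ _ (hpow t).ne']
  have hPpos : ∀ t, 0 < p t * Gd ^ t := fun t => mul_pos (hp t).1 (hpow t)
  have hDpos : ∀ t, 0 < OLG.geo D Gd t := fun t => mul_pos hD (hpow t)
  -- The price-dividend ratio is p_t / D, bounded because p converges.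
  obtain ⟨K, hK⟩ : ∃ K, ∀ t, p t * Gd ^ t ≤ K * OLG.geo D Gd t := by
    obtain ⟨K, hK⟩ := hlim.bddAbove_range
    refine ⟨K / D, fun t => ?_⟩
    rw [OLG.geo, ← mul_assoc, div_mul_cancel₀ _ hD.ne']
    exact mul_le_mul_of_nonneg_right (hK ⟨t, rfl⟩) (hpow t).le
  refine ⟨fun t => (p t, (Gd / G) ^ t),
    ⟨(OLG.isPath_iff hU hGd hG hb hD).2 ⟨fun _ => rfl, hp⟩, hlim.prodMk_nhds hr⟩,
    fun ξ' hξ' hlim' => ?_, fun t => p t * Gd ^ t, fun t => rfl, ?_, fun P' hP' hlim' => ?_,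
    ?_, OLG.noBubble_of_bounded hPpos hDpos hK,
    fun t => ⟨(OLG.hasSum_adPrice_mul hPpos hDpos hK t).summable,
      OLG.eq_fundamentalValue hPpos hDpos hK t⟩⟩
  · obtain ⟨h2, h1⟩ := (OLG.isPath_iff hU hGd hG hb hD).1 hξ'
    have := OLG.priceStep_unique hU hGd hGdG ha hb0 hD hm hp₀ h1
      ((continuous_fst.tendsto _).comp hlim') hp hlim
    funext t
    exact Prod.ext (congrFun this t) (h2 t)
  · rw [OLG.isEquilibriumPrice_iff hU hGd hG hb hD, hdetrend]
    exact hp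
  · have := OLG.priceStep_unique hU hGd hGdG ha hb0 hD hm hp₀
      ((OLG.isEquilibriumPrice_iff hU hGd hG hb hD).1 hP') hlim' hp hlim
    funext t
    rw [← congrFun this t, div_mul_cancel₀ _ (hpow t).ne']
  · rw [← hval]
    exact (((Asymptotics.isEquivalent_const_iff_tendsto hp₀.ne').2 hlim).mul
      Asymptotics.IsEquivalent.refl)
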